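/- Let $R$ be an associative ring with identity, not necessarily commutative. Let $\mathcal F$ be the class of flat right $R$-modules. A left $R$-module $M$ is called $\mathcal F$-Mittag-Leffler if for every family $(F_i)_{i\in I}$ of flat right $R$-modules the canonical map $\bigl(\prod_{i\in I}F_i\bigr)\otimes_R M\to\prod_{i\in I}(F_i\otimes_R M)$ is injective; $\mathcal M^{\mathcal F}$ denotes the class of all such modules. A left $R$-module $M$ has $\mathcal M^{\mathcal F}$-projective dimension $\le n$ if it has a projective resolution whose $(n-1)$-st syzygy belongs to $\mathcal M^{\mathcal F}$; in particular, it has $\mathcal M^{\mathcal F}$-projective dimension $\le 1$ if there is a short exact sequence $0\to K\to P\to M\to 0$ with $P$ projective and $K\in\mathcal M^{\mathcal F}$. The following assertions are equivalent: 1. $R$ is left coherent, i.e. every finitely generated left ideal of $R$ is finitely presented. 2. For each natural number $m\ge 0$, the direct product of any family of right $R$-modules of flat dimension $\le m$ has flat dimension $\le m$. 3. Each left $R$-module has $\mathcal M^{\mathcal F}$-projective dimension $\le 1$. 4. Each left ideal of $R$ is $\mathcal F$-Mittag-Leffler. 5. Each submodule of an $\mathcal F$-Mittag-Leffler left $R$-module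 is $\mathcal F$-Mittag-Leffler. -/

import Mathlib

open scoped TensorProduct

universe u v w

/-! Left modules over a (not necessarily commutative) ring `R` are `Module R M`;
right modules are `Module Rᵐᵒᵖ F`, the right action `x r` being `MulOpposite.op r • x`. -/

section Tensor

variable (R : Type u) [Ring R]
variable (F : Type v) [AddCommGroup F] [Module Rᵐᵒᵖ F]
variable (M : Type w) [AddCommGroup M] [Module R M]

/-- The subgroup of `F ⊗[ℤ] M` generated by the elements `x r ⊗ m - x ⊗ r m`. -/
def balancedRel : AddSubgroup (F ⊗[ℤ] M) :=
  AddSubgroup.closure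
    {t | ∃ (x : F) (r : R) (m : M), t = (MulOpposite.op r • x) ⊗ₜ[ℤ] m - x ⊗ₜ[ℤ] (r • m)}

/-- The tensor product over `R` of a right `R`-module `F` and a left `R`-module `M`,
an abelian group. -/
def BalTensor : Type (max v w) := (F ⊗[ℤ] M) ⧸ balancedRel R F M

instance : AddCommGroup (BalTensor R F M) :=
  inferInstanceAs (AddCommGroup ((F ⊗[ℤ] M) ⧸ balancedRel R F M))

namespace BalTensor

variable {F M}

/-- The quotient map from the tensor product over `ℤ`. -/
def ofInt : (F ⊗[ℤ] M) →+ BalTensor R F M := QuotientAddGroup.mk' (balancedRel R F M)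

/-- The pure tensor `x ⊗ m`. -/
def tmul (x : F) (m : M) : BalTensor R F M := ofInt R (x ⊗ₜ[ℤ] m)

theorem smul_tmul (x : F) (r : R) (m : M) :
    tmul R (MulOpposite.op r • x) m = tmul R x (r • m) := by
  have h : (MulOpposite.op r • x) ⊗ₜ[ℤ] m - x ⊗ₜ[ℤ] (r • m) ∈ balancedRel R F M :=
    AddSubgroup.subset_closure ⟨x, r, m, rfl⟩
  have h2 : ofInt R ((MulOpposite.op r • x) ⊗ₜ[ℤ] m - x ⊗ₜ[ℤ] (r • m)) = 0 :=
    (QuotientAddGroup.eq_zero_iff _).2 h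
  rw [map_sub, sub_eq_zero] at h2
  exact h2

theorem add_tmul (x y : F) (m : M) : tmul R (x + y) m = tmul R x m + tmul R y m := by
  simp only [tmul, TensorProduct.add_tmul, map_add]

theorem tmul_add (x : F) (m n : M) : tmul R x (m + n) = tmul R x m + tmul R x n := by
  simp only [tmul, TensorProduct.tmul_add, map_add]

variable {R}

/-- The universal property: a biadditive map `φ` with `φ (x r) m = φ x (r m)` factors through
the tensor product. -/
def lift {A : Type*} [AddCommGroup A] (φ : F →+ M →+ A)
    (hφ : ∀ (x : F) (r : R) (m : M), φ (MulOpposite.op r • x) m = φ x (r • m)) :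
    BalTensor R F M →+ A :=
  QuotientAddGroup.lift (balancedRel R F M)
    (TensorProduct.liftAddHom φ (fun z x m => by simp)) (by
      unfold balancedRel
      rw [AddSubgroup.closure_le]
      rintro _ ⟨x, r, m, rfl⟩
      simp [hφ])

@[simp] theorem lift_tmul {A : Type*} [AddCommGroup A] (φ : F →+ M →+ A)
    (hφ : ∀ (x : F) (r : R) (m : M), φ (MulOpposite.op r • x) m = φ x (r • m))
    (x : F) (m : M) : lift φ hφ (tmul R x m) = φ x m := by
  rfl

/-- Additive maps out of the tensor product are determined by the pure tensors. -/
theorem hom_ext {A : Type*} [AddCommGroup A] {f g : BalTensor R F M →+ A}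
    (h : ∀ (x : F) (m : M), f (tmul R x m) = g (tmul R x m)) : f = g := by
  apply QuotientAddGroup.addMonoidHom_ext
  ext t
  induction t using TensorProduct.induction_on with
  | zero => simp
  | tmul x m => exact h x m
  | add a b ha hb => rw [map_add, map_add, ha, hb]

/-- The map `f ⊗ g`, `x ⊗ m ↦ f x ⊗ g m`. -/
def map {F' : Type*} [AddCommGroup F'] [Module Rᵐᵒᵖ F'] {M' : Type*} [AddCommGroup M']
    [Module R M'] (f : F →ₗ[Rᵐᵒᵖ] F') (g : M →ₗ[R] M') :
    BalTensor R F M →+ BalTensor R F' M' :=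
  lift
    (AddMonoidHom.mk' (fun x => AddMonoidHom.mk' (fun m => tmul R (f x) (g m))
      (fun m n => by rw [map_add, tmul_add]))
      (fun x y => by ext m; simp [add_tmul]))
    (fun x r m => by simp [smul_tmul])

@[simp] theorem map_tmul {F' : Type*} [AddCommGroup F'] [Module Rᵐᵒᵖ F'] {M' : Type*}
    [AddCommGroup M'] [Module R M'] (f : F →ₗ[Rᵐᵒᵖ] F') (g : M →ₗ[R] M') (x : F) (m : M) :
    map f g (tmul R x m) = tmul R (f x) (g m) := by
  unfold map
  rw [lift_tmul]
  rfl

variable (R) in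
/-- The canonical map `(∏ i, G i) ⊗ M → ∏ i, (G i ⊗ M)`, `x ⊗ m ↦ (x i ⊗ m)ᵢ`. -/
def piComparison {I : Type*} (G : I → Type*) [∀ i, AddCommGroup (G i)]
    [∀ i, Module Rᵐᵒᵖ (G i)] (M : Type*) [AddCommGroup M] [Module R M] :
    BalTensor R (∀ i, G i) M →+ (∀ i, BalTensor R (G i) M) :=
  AddMonoidHom.pi fun i => map (LinearMap.proj i) LinearMap.id

end BalTensor

end Tensor

section Classes

variable (R : Type u) [Ring R]

/-- The right `R`-module `F` is flat: `F ⊗ -` preserves injectivity of maps of left modules. -/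
def IsFlatRight (F : Type u) [AddCommGroup F] [Module Rᵐᵒᵖ F] : Prop :=
  ∀ (A B : Type u) [AddCommGroup A] [Module R A] [AddCommGroup B] [Module R B]
    (g : A →ₗ[R] B), Function.Injective g →
      Function.Injective (BalTensor.map (LinearMap.id : F →ₗ[Rᵐᵒᵖ] F) g)

/-- The right `R`-module `F` has flat dimension at most `n`: there is an exact sequence
`0 → Fₙ → ⋯ → F₀ → F → 0` with all `Fᵢ` flat (peeled off one term at a time). -/
def FlatDimLE : ℕ → ∀ (F : Type u) [AddCommGroup F] [Module Rᵐᵒᵖ F], Prop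
  | 0, F, _, _ => IsFlatRight R F
  | n + 1, F, _, _ => ∃ (G : Type u) (_ : AddCommGroup G) (_ : Module Rᵐᵒᵖ G)
      (p : G →ₗ[Rᵐᵒᵖ] F), IsFlatRight R G ∧ Function.Surjective p ∧
        FlatDimLE n (LinearMap.ker p)

/-- `M` is Mittag-Leffler with respect to the class `𝒳` of right modules: for every family in
`𝒳` the canonical map `(∏ i, G i) ⊗ M → ∏ i, (G i ⊗ M)` is injective. -/
def IsMittagLefflerWrt (𝒳 : ∀ (F : Type u) [AddCommGroup F] [Module Rᵐᵒᵖ F], Prop)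
    (M : Type u) [AddCommGroup M] [Module R M] : Prop :=
  ∀ (I : Type u) (G : I → Type u) [∀ i, AddCommGroup (G i)] [∀ i, Module Rᵐᵒᵖ (G i)],
    (∀ i, 𝒳 (G i)) → Function.Injective (BalTensor.piComparison R G M)

/-- `M` is Mittag-Leffler with respect to the class of all flat right modules. -/
def IsFlatMittagLeffler (M : Type u) [AddCommGroup M] [Module R M] : Prop :=
  IsMittagLefflerWrt R (fun F _ _ => IsFlatRight R F) M

/-- The left module `M` has projective dimension at most `n` relative to the class `𝒳` of left
modules: `M` has a projective resolution whose `(n-1)`-st syzygy (`M` itself for `n = 0`, the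
kernel of `P₀ → M` for `n = 1`, and so on) lies in `𝒳`. -/
def RelProjDimLE (𝒳 : ∀ (M : Type u) [AddCommGroup M] [Module R M], Prop) :
    ℕ → ∀ (M : Type u) [AddCommGroup M] [Module R M], Prop
  | 0, M, _, _ => 𝒳 M
  | n + 1, M, _, _ => ∃ (P : Type u) (_ : AddCommGroup P) (_ : Module R P)
      (p : P →ₗ[R] M), Module.Projective R P ∧ Function.Surjective p ∧
        RelProjDimLE 𝒳 n (LinearMap.ker p)

/-- `R` is left coherent: every finitely generated left ideal is finitely presented. -/
def IsLeftCoherent : Prop :=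
  ∀ J : Submodule R R, J.FG → Module.FinitePresentation R J

end Classes

/-! The link between coherence and products is that a finitely generated left module `M` is finitely
presented as soon as all maps `R^I ⊗ M → M^I` are injective
(`finitePresentation_of_piComparison_injective`). Since `R` is flat over itself, Mittag-Leffler left
ideals therefore force coherence.

Conversely, tensoring with a finitely presented module commutes with products, and flatness can be
tested on finitely generated left ideals, so over a left coherent ring products of flat right
modules are flat (`IsLeftCoherent.isFlatRight_pi`). Products of flat resolutions then handle every
flat dimension. If `∏ G i` is flat, an inclusion `N ≤ M` stays injective after tensoring with it, so
the Mittag-Leffler property descends from `M` to `N`.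

Projective modules are Mittag-Leffler, so closure under submodules makes all their syzygies
Mittag-Leffler. Schanuel's argument makes this independent of the presentation, and `R → R ⧸ J`
recovers the ideals `J`. -/

namespace BalTensor

/-! ### Functoriality, right exactness and units of the tensor product -/

section Basic

variable {R : Type u} [Ring R]
variable {F : Type*} [AddCommGroup F] [Module Rᵐᵒᵖ F]
variable {F' : Type*} [AddCommGroup F'] [Module Rᵐᵒᵖ F']
variable {F'' : Type*} [AddCommGroup F''] [Module Rᵐᵒᵖ F'']
variable {M : Type*} [AddCommGroup M] [Module R M]
variable {M' : Type*} [AddCommGroup M'] [Module R M']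
variable {M'' : Type*} [AddCommGroup M''] [Module R M'']

variable (R F M) in
/-- The pure tensor as a biadditive map. -/
def mk : F →+ M →+ BalTensor R F M :=
  AddMonoidHom.mk' (fun x => AddMonoidHom.mk' (fun m => tmul R x m) (tmul_add R x))
    (fun x y => by ext m; exact add_tmul R x y m)

theorem mk_apply (x : F) (m : M) : mk R F M x m = tmul R x m := rfl

theorem zero_tmul (m : M) : tmul R (0 : F) m = 0 := by
  rw [← mk_apply, map_zero, AddMonoidHom.zero_apply]

theorem tmul_zero (x : F) : tmul R x (0 : M) = 0 := by
  rw [← mk_apply, map_zero]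

theorem tmul_sub (x : F) (m n : M) : tmul R x (m - n) = tmul R x m - tmul R x n := by
  simp only [← mk_apply, map_sub]

theorem tmul_sum {ι : Type*} (s : Finset ι) (x : F) (m : ι → M) :
    tmul R x (∑ j ∈ s, m j) = ∑ j ∈ s, tmul R x (m j) := by
  simp only [← mk_apply, map_sum]

@[elab_as_elim]
theorem induction_on {p : BalTensor R F M → Prop} (t : BalTensor R F M) (zero : p 0)
    (tmul : ∀ x m, p (tmul R x m)) (add : ∀ s t, p s → p t → p (s + t)) : p t := by
  obtain ⟨z, rfl⟩ := QuotientAddGroup.mk'_surjective (balancedRel R F M) t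
  induction z using TensorProduct.induction_on with
  | zero => exact zero
  | tmul x m => exact tmul x m
  | add a b ha hb => exact add _ _ ha hb

theorem map_map (f : F →ₗ[Rᵐᵒᵖ] F') (f' : F' →ₗ[Rᵐᵒᵖ] F'') (g : M →ₗ[R] M') (g' : M' →ₗ[R] M'')
    (t : BalTensor R F M) : map f' g' (map f g t) = map (f' ∘ₗ f) (g' ∘ₗ g) t := by
  induction t using induction_on with
  | zero => simp
  | tmul x m => simp
  | add s t hs ht => rw [map_add, map_add, map_add, hs, ht]

theorem map_id_id (t : BalTensor R F M) :
    map (LinearMap.id : F →ₗ[Rᵐᵒᵖ] F) (LinearMap.id : M →ₗ[R] M) t = t := by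
  induction t using induction_on with
  | zero => simp
  | tmul x m => simp
  | add s t hs ht => rw [map_add, hs, ht]

/-- Functoriality in the left module. -/
abbrev lTensor (F : Type*) [AddCommGroup F] [Module Rᵐᵒᵖ F] (g : M →ₗ[R] M') :
    BalTensor R F M →+ BalTensor R F M' :=
  map LinearMap.id g

theorem lTensor_lTensor (g : M →ₗ[R] M') (g' : M' →ₗ[R] M'') (t : BalTensor R F M) :
    lTensor F g' (lTensor F g t) = lTensor F (g' ∘ₗ g) t := by
  rw [map_map, LinearMap.id_comp]

theorem map_lTensor (f : F →ₗ[Rᵐᵒᵖ] F') (g : M →ₗ[R] M') (t : BalTensor R F M) :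
    map f LinearMap.id (lTensor F g t) = lTensor F' g (map f LinearMap.id t) := by
  simp only [map_map, LinearMap.comp_id, LinearMap.id_comp]

theorem lTensor_add (g g' : M →ₗ[R] M') (t : BalTensor R F M) :
    lTensor F (g + g') t = lTensor F g t + lTensor F g' t := by
  induction t using induction_on with
  | zero => simp
  | tmul x m => simp [tmul_add]
  | add s t hs ht => rw [map_add, map_add, map_add, hs, ht]; abel

theorem exists_sum_tmul {ι : Type*} [Fintype ι] (a : ι → M)
    (ha : Submodule.span R (Set.range a) = ⊤) (t : BalTensor R F M) :
    ∃ f : ι → F, t = ∑ j, tmul R (f j) (a j) := by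
  induction t using induction_on with
  | zero => exact ⟨0, by simp [zero_tmul]⟩
  | tmul x m =>
    obtain ⟨c, rfl⟩ := (Submodule.mem_span_range_iff_exists_fun R).1
      (ha ▸ Submodule.mem_top : m ∈ Submodule.span R (Set.range a))
    exact ⟨fun j => MulOpposite.op (c j) • x, by simp only [tmul_sum, smul_tmul]⟩
  | add s t hs ht =>
    obtain ⟨f, rfl⟩ := hs
    obtain ⟨g, rfl⟩ := ht
    exact ⟨f + g, by simp [add_tmul, Finset.sum_add_distrib]⟩

theorem lTensor_surjective {g : M →ₗ[R] M'} (hg : Function.Surjective g) :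
    Function.Surjective (lTensor F g) := by
  intro t
  induction t using induction_on with
  | zero => exact ⟨0, map_zero _⟩
  | tmul x m =>
    obtain ⟨m, rfl⟩ := hg m
    exact ⟨tmul R x m, by simp⟩
  | add s t hs ht =>
    obtain ⟨s, rfl⟩ := hs
    obtain ⟨t, rfl⟩ := ht
    exact ⟨s + t, map_add _ _ _⟩

/-- Right exactness of the tensor product. -/
theorem exists_lTensor_subtype_eq {g : M →ₗ[R] M'} (hg : Function.Surjective g)
    {t : BalTensor R F M} (ht : lTensor F g t = 0) :
    ∃ s : BalTensor R F (LinearMap.ker g), lTensor F (LinearMap.ker g).subtype s = t := by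
  let S := (lTensor F (LinearMap.ker g).subtype).range
  let q : BalTensor R F M →+ BalTensor R F M ⧸ S := QuotientAddGroup.mk' S
  have key (x : F) (m n : M) (h : g m = g n) : q (tmul R x m) = q (tmul R x n) := by
    rw [← sub_eq_zero, ← map_sub, ← tmul_sub]
    refine (QuotientAddGroup.eq_zero_iff _).2
      ⟨tmul R x ⟨m - n, by rw [LinearMap.mem_ker, map_sub, h, sub_self]⟩, ?_⟩
    simp
  have hσ := Function.surjInv_eq hg
  -- A set-theoretic section of `g` induces an additive map, because changing a preimage alters the
  -- tensor only by an element of `S`. This map recovers the class modulo `S` of `t` from its image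
  -- under `g`.
  let φ : BalTensor R F M' →+ BalTensor R F M ⧸ S := lift
    (AddMonoidHom.mk' (fun x => AddMonoidHom.mk'
        (fun m => q (tmul R x (Function.surjInv hg m)))
        (fun m n => by
          rw [← map_add, ← tmul_add]
          exact key _ _ _ (by simp only [map_add, hσ])))
      (fun x y => by ext m; simp [add_tmul]))
    (fun x r m => by
      simp only [AddMonoidHom.mk'_apply, smul_tmul]
      exact key _ _ _ (by simp only [map_smul, hσ]))
  have hφ : φ.comp (lTensor F g) = q := hom_ext fun x m => by
    rw [AddMonoidHom.comp_apply, map_tmul]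
    exact key _ _ _ (hσ _)
  have h := DFunLike.congr_fun hφ t
  rw [AddMonoidHom.comp_apply, ht, map_zero] at h
  exact (QuotientAddGroup.eq_zero_iff _).1 h.symm

/-- Every tensor comes from a finitely generated submodule of a given submodule. -/
theorem exists_fg_le_lTensor_inclusion (N : Submodule R M) (t : BalTensor R F N) :
    ∃ (N' : Submodule R M) (h : N' ≤ N), N'.FG ∧
      ∃ s : BalTensor R F N', lTensor F (Submodule.inclusion h) s = t := by
  induction t using induction_on with
  | zero => exact ⟨⊥, bot_le, Submodule.fg_bot, 0, map_zero _⟩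
  | tmul x m =>
    exact ⟨Submodule.span R {(m : M)}, (Submodule.span_singleton_le_iff_mem _ _).2 m.2,
      Submodule.fg_span_singleton _, tmul R x ⟨m, Submodule.mem_span_singleton_self _⟩,
      map_tmul _ _ _ _⟩
  | add s t hs ht =>
    obtain ⟨A, hA, fA, s, rfl⟩ := hs
    obtain ⟨B, hB, fB, t, rfl⟩ := ht
    refine ⟨A ⊔ B, sup_le hA hB, fA.sup fB,
      lTensor F (Submodule.inclusion le_sup_left) s +
        lTensor F (Submodule.inclusion le_sup_right) t, ?_⟩
    rw [map_add, lTensor_lTensor, lTensor_lTensor]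
    rfl

/-- The scalar action `R ⊗ M → M`. -/
def act : BalTensor R R M →+ M :=
  lift (AddMonoidHom.mk' (fun r => AddMonoidHom.mk' (fun m => r • m) (smul_add r))
      (fun r s => by ext m; exact add_smul r s m))
    (fun x r m => by simp [mul_smul])

theorem act_tmul (r : R) (m : M) : act (tmul R r m) = r • m := rfl

theorem one_tmul_act (t : BalTensor R R M) : tmul R (1 : R) (act t) = t := by
  induction t using induction_on with
  | zero => rw [map_zero, tmul_zero]
  | tmul r m => rw [act_tmul, ← smul_tmul]; simp
  | add s t hs ht => rw [map_add, tmul_add, hs, ht]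

theorem act_injective : Function.Injective (act : BalTensor R R M →+ M) :=
  Function.LeftInverse.injective one_tmul_act

theorem act_lTensor (g : M →ₗ[R] M') (t : BalTensor R R M) :
    act (lTensor R g t) = g (act t) := by
  induction t using induction_on with
  | zero => simp
  | tmul r m => simp [act_tmul]
  | add s t hs ht => simp only [map_add, hs, ht]

/-- The scalar action `F ⊗ R → F`. -/
def actRight : BalTensor R F R →+ F :=
  lift (AddMonoidHom.mk' (fun x => AddMonoidHom.mk' (fun r => MulOpposite.op r • x)
        (fun r s => by rw [MulOpposite.op_add, add_smul]))
      (fun x y => by ext r; exact smul_add _ x y))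
    (fun x r m => by simp [mul_smul])

theorem actRight_tmul (x : F) (r : R) : actRight (tmul R x r) = MulOpposite.op r • x := rfl

theorem actRight_tmul_one (t : BalTensor R F R) : tmul R (actRight t) (1 : R) = t := by
  induction t using induction_on with
  | zero => rw [map_zero, zero_tmul]
  | tmul x r => rw [actRight_tmul, smul_tmul, smul_eq_mul, mul_one]
  | add s t hs ht => rw [map_add, add_tmul, hs, ht]

theorem actRight_map (f : F →ₗ[Rᵐᵒᵖ] F') (t : BalTensor R F R) :
    actRight (map f LinearMap.id t) = f (actRight t) := by
  induction t using induction_on with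
  | zero => simp
  | tmul x r => simp [actRight_tmul]
  | add s t hs ht => simp only [map_add, hs, ht]

end Basic

/-! ### The comparison map with products -/

section Comparison

variable {R : Type u} [Ring R]
variable {I : Type*} {G : I → Type*} [∀ i, AddCommGroup (G i)] [∀ i, Module Rᵐᵒᵖ (G i)]
variable {M : Type*} [AddCommGroup M] [Module R M]
variable {M' : Type*} [AddCommGroup M'] [Module R M']

theorem piComparison_apply (t : BalTensor R (∀ i, G i) M) (i : I) :
    piComparison R G M t i = map (LinearMap.proj i) LinearMap.id t := rfl

theorem piComparison_lTensor (g : M →ₗ[R] M') (t : BalTensor R (∀ i, G i) M) (i : I) :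
    piComparison R G M' (lTensor _ g t) i = lTensor (G i) g (piComparison R G M t i) :=
  map_lTensor _ _ _

theorem piComparison_lTensor_eq_zero (g : M →ₗ[R] M') {t : BalTensor R (∀ i, G i) M}
    (ht : piComparison R G M t = 0) : piComparison R G M' (lTensor _ g t) = 0 := by
  funext i
  rw [piComparison_lTensor, ht, Pi.zero_apply, map_zero, Pi.zero_apply]

theorem piComparison_self_injective : Function.Injective (piComparison R G R) := by
  refine (injective_iff_map_eq_zero _).2 fun t ht => ?_
  rw [← actRight_tmul_one t]
  have : actRight t = 0 := by
    funext i
    have := congrArg actRight (congrFun ht i)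
    rwa [piComparison_apply, actRight_map, Pi.zero_apply, map_zero] at this
  rw [this, zero_tmul]

theorem piComparison_injective_of_retract (i : M →ₗ[R] M') (r : M' →ₗ[R] M)
    (hri : r ∘ₗ i = LinearMap.id) (h : Function.Injective (piComparison R G M')) :
    Function.Injective (piComparison R G M) := by
  refine (injective_iff_map_eq_zero _).2 fun t ht => ?_
  have := (injective_iff_map_eq_zero _).1 h _ (piComparison_lTensor_eq_zero i ht)
  rw [← map_id_id t, ← hri, ← lTensor, ← lTensor_lTensor, this, map_zero]

theorem piComparison_prod_injective (h : Function.Injective (piComparison R G M))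
    (h' : Function.Injective (piComparison R G M')) :
    Function.Injective (piComparison R G (M × M')) := by
  refine (injective_iff_map_eq_zero _).2 fun t ht => ?_
  have h1 := (injective_iff_map_eq_zero _).1 h _
    (piComparison_lTensor_eq_zero (LinearMap.fst R M M') ht)
  have h2 := (injective_iff_map_eq_zero _).1 h' _
    (piComparison_lTensor_eq_zero (LinearMap.snd R M M') ht)
  have e : LinearMap.inl R M M' ∘ₗ LinearMap.fst R M M' +
      LinearMap.inr R M M' ∘ₗ LinearMap.snd R M M' = LinearMap.id := by
    ext <;> simp
  rw [← map_id_id t, ← e, ← lTensor, lTensor_add, ← lTensor_lTensor, ← lTensor_lTensor, h1, h2]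
  simp

/-- A tensor involves only finitely many coordinates. Allowing every larger `s'` lets two tensors be
expanded over a common index set. -/
theorem exists_eq_sum_lTensor_single {F X : Type*} [AddCommGroup F] [Module Rᵐᵒᵖ F]
    (t : BalTensor R F (X →₀ M)) :
    ∃ s : Finset X, ∀ s', s ⊆ s' →
      t = ∑ x ∈ s', lTensor F (Finsupp.lsingle x) (lTensor F (Finsupp.lapply x) t) := by
  induction t using induction_on with
  | zero => exact ⟨∅, fun s' _ => by simp⟩
  | tmul y m =>
    refine ⟨m.support, fun s' hs' => ?_⟩
    simp only [map_tmul, LinearMap.id_apply, ← tmul_sum, Finsupp.lapply_apply,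
      Finsupp.lsingle_apply]
    congr 1
    rw [← Finsupp.sum_of_support_subset m hs' Finsupp.single (by simp), Finsupp.sum_single]
  | add s t hs ht =>
    classical
    obtain ⟨a, ha⟩ := hs
    obtain ⟨b, hb⟩ := ht
    refine ⟨a ∪ b, fun s' hs' => ?_⟩
    simp only [map_add, Finset.sum_add_distrib]
    rw [← ha s' (Finset.union_subset_left hs'), ← hb s' (Finset.union_subset_right hs')]

theorem piComparison_finsupp_injective {X : Type*} (h : Function.Injective (piComparison R G M)) :
    Function.Injective (piComparison R G (X →₀ M)) := by
  refine (injective_iff_map_eq_zero _).2 fun t ht => ?_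
  obtain ⟨s, hs⟩ := exists_eq_sum_lTensor_single t
  rw [hs s subset_rfl]
  refine Finset.sum_eq_zero fun x _ => ?_
  rw [(injective_iff_map_eq_zero _).1 h _ (piComparison_lTensor_eq_zero (Finsupp.lapply x) ht),
    map_zero]

/-- A projective module is a retract of a free one, and injectivity passes from `R` to free modules
and on to retracts. -/
theorem piComparison_projective_injective [Module.Projective R M] :
    Function.Injective (piComparison R G M) := by
  obtain ⟨s, hs⟩ := Module.projective_def'.1 (inferInstance : Module.Projective R M)
  exact piComparison_injective_of_retract s _ hs
    (piComparison_finsupp_injective piComparison_self_injective)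

/-- One finite generating family serves all indices, so the coefficients of the components assemble
into finitely many elements of the product. -/
theorem piComparison_surjective_of_finite [Module.Finite R M] :
    Function.Surjective (piComparison R G M) := by
  intro z
  obtain ⟨n, a, ha⟩ := Module.Finite.exists_fin (R := R) (M := M)
  choose f hf using fun i => exists_sum_tmul a ha (z i)
  refine ⟨∑ j, tmul R (fun i => f i j) (a j), ?_⟩
  funext i
  rw [hf i, piComparison_apply, map_sum]
  simp

/-- Tensoring with a finitely presented module commutes with products (injectivity). -/
theorem piComparison_injective_of_finitePresentation [Module.FinitePresentation R M] :
    Function.Injective (piComparison R G M) := by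
  obtain ⟨n, p, hp⟩ := Module.Finite.exists_fin' R M
  have : Module.Finite R (LinearMap.ker p) :=
    Module.Finite.iff_fg.2 (Module.FinitePresentation.fg_ker p hp)
  refine (injective_iff_map_eq_zero _).2 fun t ht => ?_
  obtain ⟨t, rfl⟩ := lTensor_surjective hp t
  -- Each component of the lift comes from `ker p`. As `ker p` is finitely generated, these
  -- components come from one tensor over the product.
  choose z hz using fun i => exists_lTensor_subtype_eq (F := G i) hp
    (t := piComparison R G _ t i) (by rw [← piComparison_lTensor, ht, Pi.zero_apply])
  obtain ⟨z, rfl⟩ := piComparison_surjective_of_finite z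
  have : lTensor _ (LinearMap.ker p).subtype z = t := by
    apply piComparison_projective_injective
    funext i
    rw [piComparison_lTensor, hz]
  rw [← this, lTensor_lTensor]
  have h0 : p ∘ₗ (LinearMap.ker p).subtype = 0 := by ext ⟨x, hx⟩; exact hx
  rw [h0]
  clear this hz ht
  induction z using induction_on with
  | zero => simp
  | tmul x m => simp [tmul_zero]
  | add s t hs ht => rw [map_add, hs, ht, add_zero]

/-- A finitely generated module `M` for which every comparison map `R^I ⊗ M → M^I` is injective
is finitely presented. -/
theorem finitePresentation_of_piComparison_injective {R : Type u} [Ring R] {M : Type*}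
    [AddCommGroup M] [Module R M] [Module.Finite R M]
    (h : ∀ I : Type u, Function.Injective (piComparison R (fun _ : I => R) M)) :
    Module.FinitePresentation R M := by
  obtain ⟨n, p, hp⟩ := Module.Finite.exists_fin' R M
  refine Module.finitePresentation_of_surjective p hp ?_
  -- The index set is `ker p` itself: `t` is the universal tensor whose component at `k` is the
  -- relation `k`, so `p` kills every component.
  let e (j : Fin n) : LinearMap.ker p → R := fun k => k.1 j
  let t : BalTensor R (LinearMap.ker p → R) (Fin n → R) := ∑ j, tmul R (e j) (Pi.single j 1)
  have act_t (k : LinearMap.ker p) :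
      act (piComparison R (fun _ : LinearMap.ker p => R) _ t k) = k.1 := by
    rw [piComparison_apply, map_sum, map_sum]
    conv_rhs => rw [pi_eq_sum_univ k.1]
    refine Finset.sum_congr rfl fun j _ => ?_
    rw [map_tmul, act_tmul]
    ext i
    simp [e, Pi.single_apply, eq_comm]
  have ht : lTensor _ p t = 0 := by
    refine (injective_iff_map_eq_zero _).1 (h _) _ ?_
    funext k
    apply act_injective
    rw [piComparison_lTensor, act_lTensor, act_t, Pi.zero_apply, map_zero]
    exact k.2
  obtain ⟨s, hs⟩ := exists_lTensor_subtype_eq hp ht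
  -- One tensor uses only a finitely generated `N ≤ ker p`. Its components, which are all the
  -- elements of `ker p`, then lie in `N`.
  obtain ⟨N, hN, hfg, s, rfl⟩ := exists_fg_le_lTensor_inclusion _ s
  suffices LinearMap.ker p = N by rwa [this]
  refine le_antisymm (fun k hk => ?_) hN
  rw [lTensor_lTensor] at hs
  have := act_t ⟨k, hk⟩
  rw [← hs, piComparison_lTensor, act_lTensor] at this
  change _ = k at this
  rw [← this]
  exact (act (piComparison R (fun _ : LinearMap.ker p => R) _ s ⟨k, hk⟩)).2

end Comparison

end BalTensor

/-! ### Flat modules and flat dimension of products -/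

section Flat

open BalTensor

variable {R : Type u} [Ring R]

theorem isFlatRight_self : IsFlatRight R R := by
  intro A B _ _ _ _ g hg s t h
  apply act_injective
  apply hg
  rw [← act_lTensor, ← act_lTensor]
  exact congrArg act h

theorem IsFlatRight.of_equiv {F F' : Type u} [AddCommGroup F] [Module Rᵐᵒᵖ F] [AddCommGroup F']
    [Module Rᵐᵒᵖ F'] (e : F ≃ₗ[Rᵐᵒᵖ] F') (h : IsFlatRight R F) : IsFlatRight R F' := by
  intro A B _ _ _ _ g hg
  refine (injective_iff_map_eq_zero _).2 fun t ht => ?_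
  have h1 : map (e.symm : F' →ₗ[Rᵐᵒᵖ] F) LinearMap.id t = 0 := by
    refine (injective_iff_map_eq_zero _).1 (h A B g hg) _ ?_
    rw [← map_lTensor, ht, map_zero]
  have h2 : map (e : F →ₗ[Rᵐᵒᵖ] F') LinearMap.id
      (map (e.symm : F' →ₗ[Rᵐᵒᵖ] F) LinearMap.id t) = t := by
    rw [map_map, LinearEquiv.comp_symm, LinearMap.id_comp, map_id_id]
  rw [← h2, h1, map_zero]

theorem FlatDimLE.of_equiv {n : ℕ} {F F' : Type u} [AddCommGroup F] [Module Rᵐᵒᵖ F]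
    [AddCommGroup F'] [Module Rᵐᵒᵖ F'] (e : F ≃ₗ[Rᵐᵒᵖ] F') (h : FlatDimLE R n F) :
    FlatDimLE R n F' := by
  cases n with
  | zero => exact IsFlatRight.of_equiv e h
  | succ n =>
    obtain ⟨G, _, _, p, hG, hp, hk⟩ := h
    refine ⟨G, _, _, (e : F →ₗ[Rᵐᵒᵖ] F') ∘ₗ p, hG, e.surjective.comp hp, ?_⟩
    rwa [LinearEquiv.ker_comp]

/-- The kernel of a product of maps is the product of the kernels. -/
def LinearMap.kerPiMapEquiv {S : Type*} [Ring S] {I : Type*} {G F : I → Type*}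
    [∀ i, AddCommGroup (G i)] [∀ i, Module S (G i)] [∀ i, AddCommGroup (F i)]
    [∀ i, Module S (F i)] (p : ∀ i, G i →ₗ[S] F i) :
    (∀ i, LinearMap.ker (p i)) ≃ₗ[S]
      LinearMap.ker (LinearMap.pi fun i => p i ∘ₗ LinearMap.proj i) where
  toFun x := ⟨fun i => x i, by ext i; exact (x i).2⟩
  invFun y i := ⟨y.1 i, congrFun y.2 i⟩
  map_add' _ _ := rfl
  map_smul' _ _ := rfl
  left_inv _ := rfl
  right_inv _ := rfl

theorem flatDimLE_pi
    (h : ∀ (I : Type u) (F : I → Type u) [∀ i, AddCommGroup (F i)] [∀ i, Module Rᵐᵒᵖ (F i)],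
      (∀ i, IsFlatRight R (F i)) → IsFlatRight R (∀ i, F i))
    (n : ℕ) {I : Type u} (F : I → Type u) [∀ i, AddCommGroup (F i)] [∀ i, Module Rᵐᵒᵖ (F i)]
    (hF : ∀ i, FlatDimLE R n (F i)) : FlatDimLE R n (∀ i, F i) := by
  induction n generalizing F with
  | zero => exact h I F hF
  | succ n ih =>
    choose G _ _ p hG hp hk using hF
    refine ⟨∀ i, G i, inferInstance, inferInstance,
      LinearMap.pi fun i => p i ∘ₗ LinearMap.proj i, h I G hG, fun y => ?_,
      (ih _ hk).of_equiv (LinearMap.kerPiMapEquiv p)⟩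
    choose x hx using fun i => hp i (y i)
    exact ⟨x, funext hx⟩

end Flat

/-! ### Testing flatness on left ideals through the character module -/

section Baer

open BalTensor

variable {R : Type u} [Ring R]
variable {F : Type*} [AddCommGroup F] [Module Rᵐᵒᵖ F]
variable {M : Type*} [AddCommGroup M] [Module R M]

variable (R F) in
/-- The left module structure on the character module of a right module. -/
abbrev CharacterModule.leftModule : Module R (CharacterModule F) where
  smul r c := c.comp (DistribSMul.toAddMonoidHom F (MulOpposite.op r))
  one_smul c := by ext x; exact congrArg c (one_smul _ x)
  mul_smul r s c := by ext x; exact congrArg c (mul_smul (MulOpposite.op s) (MulOpposite.op r) x)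
  smul_zero _ := rfl
  smul_add _ _ _ := rfl
  add_smul r s c := by
    ext x
    exact (congrArg c (add_smul (MulOpposite.op r) (MulOpposite.op s) x)).trans (map_add c _ _)
  zero_smul c := by
    ext x
    exact (congrArg c (zero_smul Rᵐᵒᵖ x)).trans (map_zero c)

attribute [local instance] CharacterModule.leftModule

/-- A character of `F ⊗ M` is a linear map from `M` to the character module of `F`. -/
def BalTensor.characterCurry (c : CharacterModule (BalTensor R F M)) :
    M →ₗ[R] CharacterModule F where
  toFun m := AddMonoidHom.comp c ((mk R F M).flip m)
  map_add' m n := by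
    ext x
    exact (congrArg c (tmul_add R x m n)).trans (map_add c _ _)
  map_smul' r m := by
    ext x
    exact congrArg c (smul_tmul R x r m).symm

/-- A linear map from `M` to the character module of `F` is a character of `F ⊗ M`. -/
def BalTensor.characterUncurry (g : M →ₗ[R] CharacterModule F) :
    CharacterModule (BalTensor R F M) :=
  lift (AddMonoidHom.mk' (fun x => AddMonoidHom.mk' (fun m => g m x)
        (fun m n => by rw [map_add]; rfl))
      (fun x y => by ext m; exact map_add (g m) x y))
    (fun x r m => (DFunLike.congr_fun (map_smul g r m) x).symm)

theorem BalTensor.characterCurry_apply (c : CharacterModule (BalTensor R F M)) (m : M) (x : F) :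
    characterCurry c m x = c (tmul R x m) := rfl

theorem BalTensor.lTensor_subtype_injective_of_fg
    (h : ∀ J : Submodule R R, J.FG → Function.Injective (lTensor F J.subtype))
    (J : Submodule R R) : Function.Injective (lTensor F J.subtype) := by
  refine (injective_iff_map_eq_zero _).2 fun t ht => ?_
  obtain ⟨N, hN, hfg, s, rfl⟩ := exists_fg_le_lTensor_inclusion J t
  rw [lTensor_lTensor] at ht
  rw [(injective_iff_map_eq_zero _).1 (h N hfg) s ht, map_zero]

theorem CharacterModule.baer_of_lTensor_subtype_injective
    (h : ∀ J : Submodule R R, Function.Injective (lTensor F J.subtype)) :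
    Module.Baer R (CharacterModule F) := by
  intro J g
  -- By the adjunction, `g` is a character of `F ⊗ J`. It extends along the injection into `F ⊗ R`.
  obtain ⟨c, hc⟩ := CharacterModule.dual_surjective_of_injective
    (lTensor F J.subtype).toIntLinearMap (h J) (characterUncurry g)
  refine ⟨characterCurry c, fun r hr => ?_⟩
  ext x
  rw [characterCurry_apply]
  exact DFunLike.congr_fun hc (tmul R x (⟨r, hr⟩ : J))

/-- It suffices to test flatness on finitely generated left ideals. -/
theorem isFlatRight_of_lTensor_subtype_injective {F : Type u} [AddCommGroup F] [Module Rᵐᵒᵖ F]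
    (h : ∀ J : Submodule R R, J.FG → Function.Injective (lTensor F J.subtype)) :
    IsFlatRight R F := by
  have hB := CharacterModule.baer_of_lTensor_subtype_injective
    (lTensor_subtype_injective_of_fg h)
  intro A B _ _ _ _ g hg
  refine (injective_iff_map_eq_zero _).2 fun t ht => ?_
  refine CharacterModule.eq_zero_of_character_apply fun c => ?_
  -- By Baer's criterion every character of `F ⊗ A` factors through `F ⊗ B`, hence kills `t`;
  -- characters separate points.
  obtain ⟨k, hk⟩ := hB.extension_property g hg (characterCurry c)
  have : AddMonoidHom.comp (characterUncurry k) (lTensor F g) = c := hom_ext fun x a =>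
    DFunLike.congr_fun (DFunLike.congr_fun hk a) x
  rw [← this]
  exact (congrArg (characterUncurry k) ht).trans (map_zero _)

end Baer

/-! ### Mittag-Leffler modules and the equivalence -/

section Main

open BalTensor

variable {R : Type u} [Ring R]

/-- Chase: over a left coherent ring, products of flat right modules are flat. -/
theorem IsLeftCoherent.isFlatRight_pi (hR : IsLeftCoherent R) {I : Type u} (F : I → Type u)
    [∀ i, AddCommGroup (F i)] [∀ i, Module Rᵐᵒᵖ (F i)] (hF : ∀ i, IsFlatRight R (F i)) :
    IsFlatRight R (∀ i, F i) := by
  refine isFlatRight_of_lTensor_subtype_injective fun J hJ => ?_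
  have := hR J hJ
  refine (injective_iff_map_eq_zero _).2 fun t ht => ?_
  apply (injective_iff_map_eq_zero _).1 piComparison_injective_of_finitePresentation
  funext i
  refine (injective_iff_map_eq_zero _).1 (hF i J R J.subtype J.injective_subtype) _ ?_
  rw [← piComparison_lTensor, ht, map_zero, Pi.zero_apply]

theorem IsFlatMittagLeffler.of_injective
    (h : ∀ (I : Type u) (F : I → Type u) [∀ i, AddCommGroup (F i)] [∀ i, Module Rᵐᵒᵖ (F i)],
      (∀ i, IsFlatRight R (F i)) → IsFlatRight R (∀ i, F i))
    {M N : Type u} [AddCommGroup M] [Module R M] [AddCommGroup N] [Module R N]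
    (hM : IsFlatMittagLeffler R M) (f : N →ₗ[R] M) (hf : Function.Injective f) :
    IsFlatMittagLeffler R N := by
  intro I G _ _ hG
  refine (injective_iff_map_eq_zero _).2 fun t ht => ?_
  refine (injective_iff_map_eq_zero _).1 (h I G hG N M f hf) t ?_
  exact (injective_iff_map_eq_zero _).1 (hM I G hG) _ (piComparison_lTensor_eq_zero f ht)

theorem IsFlatMittagLeffler.of_projective (M : Type u) [AddCommGroup M] [Module R M]
    [Module.Projective R M] : IsFlatMittagLeffler R M :=
  fun _ _ _ _ _ => piComparison_projective_injective

/-- Whether the kernel of a projective presentation of `M` is Mittag-Leffler does not depend on the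
presentation: by Schanuel's argument `ker q` is a retract of `ker p × Q`. -/
theorem isFlatMittagLeffler_of_ker {M Q P : Type u} [AddCommGroup M] [Module R M]
    [AddCommGroup Q] [Module R Q] [Module.Projective R Q] [AddCommGroup P] [Module R P]
    [Module.Projective R P] (p : P →ₗ[R] M) (hp : Function.Surjective p) (q : Q →ₗ[R] M)
    (hq : Function.Surjective q) (h : IsFlatMittagLeffler R (LinearMap.ker p)) :
    IsFlatMittagLeffler R (LinearMap.ker q) := by
  obtain ⟨α, hα⟩ := Module.projective_lifting_property p q hp
  obtain ⟨β, hβ⟩ := Module.projective_lifting_property q p hq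
  replace hα x : p (α x) = q x := DFunLike.congr_fun hα x
  replace hβ x : q (β x) = p x := DFunLike.congr_fun hβ x
  -- The retract is given by `x ↦ (α x, x)` and `(k, y) ↦ β k + (y - β (α y))`; the last term lies
  -- in `ker q` because `q ∘ β ∘ α = q`.
  let i : LinearMap.ker q →ₗ[R] LinearMap.ker p × Q :=
    (α.restrict fun x hx => (hα x).trans hx).prod (LinearMap.ker q).subtype
  let r : LinearMap.ker p × Q →ₗ[R] LinearMap.ker q :=
    (β.restrict fun x hx => (hβ x).trans hx).coprod
      ((LinearMap.id - β ∘ₗ α).codRestrict _ fun x => by simp [hα, hβ])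
  intro I G _ _ hG
  refine piComparison_injective_of_retract i r ?_
    (piComparison_prod_injective (h I G hG) piComparison_projective_injective)
  ext x
  change β (α x) + (x.1 - β (α x)) = x
  exact add_sub_cancel _ _

end Main

theorem corollaryc (R : Type u) [Ring R] :
    [ -- `R` is left coherent
      IsLeftCoherent R,
      -- products of right modules of flat dimension `≤ m` have flat dimension `≤ m`
      ∀ (m : ℕ) (I : Type u) (F : I → Type u) [∀ i, AddCommGroup (F i)]
        [∀ i, Module Rᵐᵒᵖ (F i)],
        (∀ i, FlatDimLE R m (F i)) → FlatDimLE R m (∀ i, F i),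
      -- every left module has relative projective dimension `≤ 1`
      ∀ (M : Type u) [AddCommGroup M] [Module R M],
        RelProjDimLE R (fun N _ _ => IsFlatMittagLeffler R N) 1 M,
      -- every left ideal is Mittag-Leffler with respect to the flat right modules
      ∀ J : Submodule R R, IsFlatMittagLeffler R J,
      -- submodules of such Mittag-Leffler left modules are again such
      ∀ (M : Type u) [AddCommGroup M] [Module R M], IsFlatMittagLeffler R M →
        ∀ N : Submodule R M, IsFlatMittagLeffler R N ].TFAE := by
  tfae_have 1 → 2 := fun h m I F _ _ hF =>
    flatDimLE_pi (fun _ F _ _ hF => h.isFlatRight_pi F hF) m F hF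
  tfae_have 2 → 5 := fun h M _ _ hM N =>
    hM.of_injective (fun I F _ _ hF => h 0 I F hF) N.subtype N.injective_subtype
  tfae_have 5 → 3 := fun h M _ _ =>
    ⟨M →₀ R, inferInstance, inferInstance, Finsupp.linearCombination R id, inferInstance,
      Finsupp.linearCombination_id_surjective R M,
      h (M →₀ R) (IsFlatMittagLeffler.of_projective _) _⟩
  tfae_have 3 → 4 := fun h J => by
    obtain ⟨P, _, _, p, _, hp, hK⟩ := h (R ⧸ J)
    have := isFlatMittagLeffler_of_ker p hp J.mkQ J.mkQ_surjective hK
    rwa [Submodule.ker_mkQ] at this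
  tfae_have 4 → 1 := fun h J hJ => by
    have : Module.Finite R J := Module.Finite.iff_fg.2 hJ
    exact BalTensor.finitePresentation_of_piComparison_injective fun I =>
      h J I (fun _ => R) fun _ => isFlatRight_self
  tfae_finish
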